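/- Let $M$ be a connected Riemannian $n$-manifold and let $\mathbf x: M\to\mathbb E^m$ be a smooth isometric immersion into Euclidean $m$-space. At each point decompose the position vector as $\mathbf x=\mathbf x^T+\mathbf x^N$ into its components tangent and normal to $M$. Let $h$ be the second fundamental form and $A$ the shape operator, so that for a normal vector field $\xi$ and a tangent vector $X$, $A_\xi X$ is minus the tangential component of the derivative of $\xi$ in the direction $X$. Assume that $M$ is a proper rectifying submanifold: at every $p\in M$ the vector $\mathbf x(p)$ is orthogonal to the first normal space $\operatorname{Im}h_p=\operatorname{Span}\{h(X,Y): X,Y\in T_pM\}$, and $\mathbf x\neq\mathbf x^T$ and $\mathbf x\ne\mathbf x^N$ at every point. Put $e_1=\mathbf x^T/|\mathbf x^T|$. Below, $s$ denotes any smooth function on a connected open set $U\subseteq M$ with $ds(e_1)=1$ and $ds(v)=0$ for all tangent vectors $v\perp e_1$ (for instance the first coordinate of a local coordinate system $(s,u_2,\dots,u_n)$ with $\partial/\partial s=e_1$ and all $\partial/\partial u_j$ orthogonal to $e_1$). Such functions exist on a neighbourhood of each point of $M$, and the following hold. (a) $|\mathbf x^T|=s+b$ on $U$ for some constant $b$.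 (b) $|\mathbf x|^2=s^2+c_1s+c_2$ on $U$ for some constants $c_1,c_2$. (c) $\mathbf x^N$ has constant length on $M$. (d) $A_{\mathbf x^N}=0$. (e) The Riemann curvature tensor $R$ of $M$ satisfies $R(\mathbf x^T,Y)=0$ for every tangent vector $Y$. (f) The sectional curvature $K$ of $M$ satisfies $K(\mathbf x^T,Z)=0$ for every unit tangent vector $Z$ perpendicular to $\mathbf x^T$. -/

import Mathlib

open Bundle
open scoped Manifold ContDiff

noncomputable section

namespace RectSub

/-- Euclidean `n`-space. -/
abbrev Euc (n : ℕ) : Type := EuclideanSpace ℝ (Fin n)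

variable {n m : ℕ} {M : Type*} [TopologicalSpace M] [ChartedSpace (Euc n) M]

/-! ### The curvature of a Riemannian manifold

The metric is Mathlib's `RiemannianBundle` structure on the tangent bundle. Its Levi-Civita
connection and its curvature tensor at `p` are computed by the classical coordinate formulas in the
preferred chart at `p` (the result does not depend on the chart, curvature being a tensor). -/

section Intrinsic

/-- The coordinate vector field `∂/∂yⁱ` of the chart at `p`, at the point with coordinates `y`. -/
def coordField (p : M) (i : Fin n) (y : Euc n) :
    TangentSpace (𝓡 n) ((extChartAt (𝓡 n) p).symm y) :=
  mfderiv 𝓘(ℝ, Euc n) (𝓡 n) (extChartAt (𝓡 n) p).symm y (EuclideanSpace.single i (1 : ℝ))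

/-- The coordinates of a tangent vector at `p` in the chart at `p`. -/
def coords (p : M) (v : TangentSpace (𝓡 n) p) : Euc n :=
  mvfderiv (𝓡 n) (extChartAt (𝓡 n) p) p v

/-- The tangent vector at `p` with the given coordinates in the chart at `p`. -/
def ofCoords (p : M) (a : Euc n) : TangentSpace (𝓡 n) p :=
  (mvfderiv (𝓡 n) (extChartAt (𝓡 n) p) p).inverse a

/-- The partial derivative `∂f/∂yⁱ` at `y`. -/
def partialD (i : Fin n) (f : Euc n → ℝ) (y : Euc n) : ℝ :=
  fderiv ℝ f y (EuclideanSpace.single i (1 : ℝ))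

variable [RiemannianBundle (fun p : M => TangentSpace (𝓡 n) p)]

/-- The matrix `g_{ij} = ⟨∂_i, ∂_j⟩` of the metric in the chart at `p`. -/
def metricMatrix (p : M) (y : Euc n) : Matrix (Fin n) (Fin n) ℝ :=
  Matrix.of fun i j => inner ℝ (coordField p i y) (coordField p j y)

/-- The Christoffel symbols of the Levi-Civita connection,
`Γᵏ_{ij} = ½ ∑_l g^{kl} (∂_i g_{jl} + ∂_j g_{il} - ∂_l g_{ij})`, so that
`∇_{∂_i} ∂_j = ∑_k Γᵏ_{ij} ∂_k`. -/
def christoffel (p : M) (k i j : Fin n) (y : Euc n) : ℝ :=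
  (1 / 2 : ℝ) * ∑ l, (metricMatrix p y)⁻¹ k l *
    (partialD i (fun z => metricMatrix p z j l) y + partialD j (fun z => metricMatrix p z i l) y
      - partialD l (fun z => metricMatrix p z i j) y)

/-- The components of the curvature tensor: `R(∂_i, ∂_j) ∂_k = ∑_l curvCoeff l i j k • ∂_l` for
`R(X, Y) Z = ∇_X ∇_Y Z - ∇_Y ∇_X Z - ∇_[X, Y] Z`. -/
def curvCoeff (p : M) (l i j k : Fin n) (y : Euc n) : ℝ :=
  partialD i (christoffel p l j k) y - partialD j (christoffel p l i k) y
    + ∑ a, (christoffel p l i a y * christoffel p a j k y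
      - christoffel p l j a y * christoffel p a i k y)

/-- The curvature tensor `R(u, v) w` of `M` at `p`. -/
def curvature (p : M) (u v w : TangentSpace (𝓡 n) p) : TangentSpace (𝓡 n) p :=
  ofCoords p (WithLp.toLp 2 fun l => ∑ i, ∑ j, ∑ k,
    curvCoeff p l i j k (extChartAt (𝓡 n) p p) * coords p u i * coords p v j * coords p w k)

/-- The sectional curvature of the plane spanned by (linearly independent) `u` and `v`. -/
def sectionalCurvature (p : M) (u v : TangentSpace (𝓡 n) p) : ℝ :=
  inner ℝ (curvature p u v v) u / (‖u‖ ^ 2 * ‖v‖ ^ 2 - inner ℝ u v ^ 2)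

end Intrinsic

/-! ### Submanifolds of Euclidean space -/

-- The dimension of `M` is an explicit argument from here on.
variable (n)

/-- The tangent space of the immersion `x` at `p`, as a subspace of the ambient space. -/
def tangentImage (x : M → Euc m) (p : M) : Submodule ℝ (Euc m) :=
  LinearMap.range (mvfderiv (𝓡 n) x p : TangentSpace (𝓡 n) p →ₗ[ℝ] Euc m)

/-- The tangential component of an ambient vector. -/
def tangentPart (x : M → Euc m) (p : M) (v : Euc m) : Euc m :=
  (tangentImage n x p).starProjection v

/-- The normal component of an ambient vector. -/
def normalPart (x : M → Euc m) (p : M) (v : Euc m) : Euc m :=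
  v - tangentPart n x p v

theorem exists_mvfderiv_eq_tangentPart (x : M → Euc m) (p : M) (v : Euc m) :
    ∃ u : TangentSpace (𝓡 n) p, mvfderiv (𝓡 n) x p u = tangentPart n x p v :=
  LinearMap.mem_range.mp ((tangentImage n x p).starProjection_apply_mem v)

/-- The tangential component of an ambient vector, as a tangent vector of `M` (it is unique since
`x` is an immersion). -/
def tangentVec (x : M → Euc m) (p : M) (v : Euc m) : TangentSpace (𝓡 n) p :=
  (exists_mvfderiv_eq_tangentPart n x p v).choose

/-- `𝐱ᵀ` as an ambient vector. -/
def posT (x : M → Euc m) (p : M) : Euc m := tangentPart n x p (x p)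

/-- `𝐱ᴺ`. -/
def posN (x : M → Euc m) (p : M) : Euc m := normalPart n x p (x p)

/-- `𝐱ᵀ` as a tangent vector of `M`. -/
def posTVec (x : M → Euc m) (p : M) : TangentSpace (𝓡 n) p := tangentVec n x p (x p)

/-- The second fundamental form `h(v, w)` at `p`: the normal component of the derivative in the
direction `v` of the tangent vector field that extends `w` with constant coefficients in the chart
at `p` (the normal component does not depend on the extension). -/
def secondFF (x : M → Euc m) (p : M) (v w : TangentSpace (𝓡 n) p) : Euc m :=
  normalPart n x p
    (fderiv ℝ (fun y => fderiv ℝ (fun z => x ((extChartAt (𝓡 n) p).symm z)) y (coords p w))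
      (extChartAt (𝓡 n) p p) (coords p v))

/-- The first normal space `Im h_p`. -/
def firstNormalSpace (x : M → Euc m) (p : M) : Submodule ℝ (Euc m) :=
  Submodule.span ℝ {ξ | ∃ v w : TangentSpace (𝓡 n) p, ξ = secondFF n x p v w}

/-- The rectifying space: the orthogonal complement of the first normal space. -/
def rectifyingSpace (x : M → Euc m) (p : M) : Submodule ℝ (Euc m) :=
  (firstNormalSpace n x p)ᗮ

/-- The position vector always lies in the rectifying space. -/
def IsRectifying (x : M → Euc m) : Prop :=
  ∀ p, x p ∈ rectifyingSpace n x p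

/-- A rectifying submanifold with `𝐱 ≠ 𝐱ᵀ` and `𝐱 ≠ 𝐱ᴺ` at every point. -/
def IsProperRectifying (x : M → Euc m) : Prop :=
  IsRectifying n x ∧ ∀ p, x p ≠ posT n x p ∧ x p ≠ posN n x p

/-- The shape operator `A_ξ` of a normal vector field `ξ`, from Weingarten's formula:
`A_ξ v` is minus the tangential component of the derivative of `ξ` in the direction `v`. -/
def shapeOperator (x ξ : M → Euc m) (p : M) (v : TangentSpace (𝓡 n) p) :
    TangentSpace (𝓡 n) p :=
  -tangentVec n x p (mvfderiv (𝓡 n) ξ p v)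

variable [RiemannianBundle (fun p : M => TangentSpace (𝓡 n) p)]

/-- A smooth map into Euclidean space whose differentials preserve inner products. -/
def IsIsometricImmersion (x : M → Euc m) : Prop :=
  ContMDiff (𝓡 n) 𝓘(ℝ, Euc m) ∞ x ∧
    ∀ (p : M) (v w : TangentSpace (𝓡 n) p),
      inner ℝ (mvfderiv (𝓡 n) x p v) (mvfderiv (𝓡 n) x p w) = inner ℝ v w

/-- The unit vector field `e₁ = 𝐱ᵀ / |𝐱ᵀ|`. -/
def unitT (x : M → Euc m) (p : M) : TangentSpace (𝓡 n) p :=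
  ‖posTVec n x p‖⁻¹ • posTVec n x p

/-- `s` is a smooth function on `U` with `ds(e₁) = 1` and `ds = 0` on the orthogonal complement of
`e₁`, that is, `grad s = e₁`. The first coordinate of every local coordinate system
`(s, u₂, …, uₙ)` for which `∂/∂s = e₁` and the `∂/∂u_j` are orthogonal to `e₁` is of this kind. -/
def IsArclengthCoord (x : M → Euc m) (U : Set M) (s : M → ℝ) : Prop :=
  ContMDiffOn (𝓡 n) 𝓘(ℝ, ℝ) ∞ s U ∧
    ∀ p ∈ U, mvfderiv (𝓡 n) s p (unitT n x p) = 1 ∧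
      ∀ v : TangentSpace (𝓡 n) p, inner ℝ v (unitT n x p) = 0 → mvfderiv (𝓡 n) s p v = 0

end RectSub

end

/-! Everything follows from differentiating orthogonality relations in a chart. Write `F` for the
immersion in coordinates, `T` and `N` for the tangential and normal parts of the position vector,
and `h` for the second fundamental form. The rectifying condition says `⟨N, ∂ᵢ∂ⱼF⟩ = 0`.

Differentiating `⟨N, ∂_q F⟩ = 0` shows that `∂ᵢN` is normal, which is (d). Since `F = T + N`, the
normal component of `∂ᵢN` is `-h(∂ᵢ, T)` (`inner_pder_paramN`). This is orthogonal to `N`, so `|N|`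
is constant, which is (c).

For (e), the Gauss equation expresses `⟨R(T, ∂ⱼ)∂ₖ, ∂_q⟩` through products of `h` with `h(T, ·)`,
that is, with derivatives of `N`. It becomes `⟨∂ₖN, ∂ⱼ∂_qF⟩ - ⟨∂_qN, ∂ⱼ∂ₖF⟩`. Differentiating the
rectifying condition turns each term into a pairing of `N` with the same third derivative of `F`, so
they cancel (`sum_tanCoeff_mul_paramCurv`). (f) is a special case.

For (a) and (b), `|T|² = |F|² - |N|²` with `|N|` constant, and `|F|²` has gradient `2T`. Hence `|T|`
is smooth with gradient `e₁`. It is therefore itself an admissible `s`, and any other one differs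
from it by a constant on a connected open set.

The remaining work identifies the intrinsic chart formulas with those of the parametrization:
`christoffel_eq`, `curvCoeff_eq` and the change of charts in `inner_paramN_pder_pder`. -/

noncomputable section

namespace RectSub

/-! ### Coefficients with respect to a frame -/

section Frame

variable {ι V : Type*} [Fintype ι] [DecidableEq ι] [NormedAddCommGroup V] [InnerProductSpace ℝ V]

/-- The coefficients in the frame `d` of the orthogonal projection of `w` to the span of `d`. -/
def frameCoeff (d : ι → V) (w : V) (k : ι) : ℝ :=
  ∑ l, (Matrix.gram ℝ d)⁻¹ k l * inner ℝ w (d l)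

theorem inner_sum_frameCoeff {d : ι → V} (hd : LinearIndependent ℝ d) (w : V) (q : ι) :
    inner ℝ (∑ k, frameCoeff d w k • d k) (d q) = inner ℝ w (d q) := by
  have hu : IsUnit (Matrix.gram ℝ d).det :=
    isUnit_iff_ne_zero.mpr (Matrix.det_gram_ne_zero_iff_linearIndependent.mpr hd)
  have h := congrFun (congrArg (fun A => A.mulVec fun l => inner ℝ w (d l))
    (Matrix.mul_nonsing_inv _ hu)) q
  rw [Matrix.one_mulVec, ← Matrix.mulVec_mulVec] at h
  rw [← h, sum_inner]
  simp only [Matrix.mulVec, dotProduct, frameCoeff, inner_smul_left, Matrix.gram_apply]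
  refine Finset.sum_congr rfl fun k _ => ?_
  rw [real_inner_comm (d k) (d q)]
  simp [mul_comm]

theorem inner_sub_sum_frameCoeff {d : ι → V} (hd : LinearIndependent ℝ d) (w : V) (q : ι) :
    inner ℝ (w - ∑ k, frameCoeff d w k • d k) (d q) = 0 := by
  rw [inner_sub_left, inner_sum_frameCoeff hd, sub_self]

/-- By Cramer's rule the inverse Gram matrix is polynomial in the inner products, divided by a
determinant that is nonzero because the frame is independent. Smoothness of Christoffel symbols,
`T`, `N` and `h` rests on this. -/
theorem contDiffAt_frameCoeff {E : Type*} [NormedAddCommGroup E] [NormedSpace ℝ E] {r : ℕ∞ω}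
    {d : E → ι → V} {w : E → V} {y : E} (hd : ∀ i, ContDiffAt ℝ r (fun z => d z i) y)
    (hw : ContDiffAt ℝ r w y) (hli : LinearIndependent ℝ (d y)) (k : ι) :
    ContDiffAt ℝ r (fun z => frameCoeff (d z) (w z) k) y := by
  have hentry : ∀ i j, ContDiffAt ℝ r (fun z => Matrix.gram ℝ (d z) i j) y := fun i j => by
    simpa only [Matrix.gram_apply] using (hd i).inner ℝ (hd j)
  have hdet : ∀ A : E → Matrix ι ι ℝ, (∀ i j, ContDiffAt ℝ r (fun z => A z i j) y) →
      ContDiffAt ℝ r (fun z => (A z).det) y := fun A hA => by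
    simp only [Matrix.det_apply, Units.smul_def, zsmul_eq_mul]
    exact ContDiffAt.sum fun σ _ => contDiffAt_const.mul (contDiffAt_prod fun i _ => hA _ _)
  unfold frameCoeff
  refine ContDiffAt.sum fun l _ => ContDiffAt.mul ?_ (hw.inner ℝ (hd l))
  simp only [Matrix.inv_def, Matrix.smul_apply, smul_eq_mul, Ring.inverse_eq_inv',
    Matrix.adjugate_apply]
  refine ((hdet _ hentry).inv (Matrix.det_gram_ne_zero_iff_linearIndependent.mpr hli)).mul
    (hdet _ fun i j => ?_)
  by_cases h : i = l
  · subst h; simpa using contDiffAt_const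
  · simpa [Matrix.updateRow_apply, h] using hentry i j

end Frame

/-! ### Parametrized submanifolds -/

section Param

variable {n : ℕ} {V : Type*} [NormedAddCommGroup V] [InnerProductSpace ℝ V]

/-- The partial derivative of a vector valued function. -/
def pder (i : Fin n) (f : Euc n → V) (y : Euc n) : V :=
  fderiv ℝ f y (EuclideanSpace.single i (1 : ℝ))

/-- A smooth immersion of the open set `S`. -/
structure IsParam (F : Euc n → V) (S : Set (Euc n)) : Prop where
  isOpen : IsOpen S
  smooth : ∀ y ∈ S, ContDiffAt ℝ ∞ F y
  injective : ∀ y ∈ S, Function.Injective (fderiv ℝ F y)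

/-- The Christoffel symbols of a parametrized submanifold. -/
def paramChristoffel (F : Euc n → V) (k i j : Fin n) (y : Euc n) : ℝ :=
  frameCoeff (fun l => pder l F y) (pder i (pder j F) y) k

/-- The second fundamental form of a parametrized submanifold. -/
def paramSFF (F : Euc n → V) (i j : Fin n) (y : Euc n) : V :=
  pder i (pder j F) y - ∑ k, paramChristoffel F k i j y • pder k F y

/-- The components of the tangential part of the position vector. -/
def tanCoeff (F : Euc n → V) (k : Fin n) (y : Euc n) : ℝ :=
  frameCoeff (fun l => pder l F y) (F y) k

/-- The normal part of the position vector. -/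
def paramN (F : Euc n → V) (y : Euc n) : V :=
  F y - ∑ k, tanCoeff F k y • pder k F y

/-- The components of the curvature tensor of a parametrized submanifold. -/
def paramCurv (F : Euc n → V) (l i j k : Fin n) (y : Euc n) : ℝ :=
  pder i (paramChristoffel F l j k) y - pder j (paramChristoffel F l i k) y
    + ∑ a, (paramChristoffel F l i a y * paramChristoffel F a j k y
      - paramChristoffel F l j a y * paramChristoffel F a i k y)

theorem contDiffAt_pder {f : Euc n → V} {y : Euc n} (h : ContDiffAt ℝ ∞ f y) (i : Fin n) :
    ContDiffAt ℝ ∞ (pder i f) y :=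
  (h.fderiv_right (m := ∞) (by simp)).clm_apply contDiffAt_const

theorem pder_comm {f : Euc n → V} {y : Euc n} (h : ContDiffAt ℝ ∞ f y) (i j : Fin n) :
    pder i (pder j f) y = pder j (pder i f) y := by
  have hd : DifferentiableAt ℝ (fderiv ℝ f) y :=
    (h.fderiv_right (m := ∞) (by simp)).differentiableAt (by simp)
  have key : ∀ a b : Fin n, pder a (pder b f) y = fderiv ℝ (fderiv ℝ f) y
      (EuclideanSpace.single a 1) (EuclideanSpace.single b 1) := fun a b => by
    unfold pder
    rw [fderiv_clm_apply hd (differentiableAt_const _)]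
    simp
  rw [key, key]
  exact h.isSymmSndFDerivAt (by
    rw [minSmoothness_of_isRCLikeNormedField]; exact ENat.LEInfty.out) _ _

theorem pder_congr {f g : Euc n → V} {S : Set (Euc n)} (hS : IsOpen S) {y : Euc n} (hy : y ∈ S)
    (h : ∀ z ∈ S, f z = g z) (i : Fin n) : pder i f y = pder i g y := by
  have h' : f =ᶠ[nhds y] g := Filter.eventually_of_mem (hS.mem_nhds hy) h
  unfold pder
  rw [h'.fderiv_eq]

theorem pder_inner {f g : Euc n → V} {y : Euc n} (hf : ContDiffAt ℝ ∞ f y)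
    (hg : ContDiffAt ℝ ∞ g y) (i : Fin n) :
    pder i (fun z => (inner ℝ (f z) (g z) : ℝ)) y
      = inner ℝ (f y) (pder i g y) + inner ℝ (pder i f y) (g y) :=
  fderiv_inner_apply ℝ (hf.differentiableAt (by simp)) (hg.differentiableAt (by simp)) _

theorem pder_sum_smul {c : Fin n → Euc n → ℝ} {v : Fin n → Euc n → V} {y : Euc n}
    (hc : ∀ k, ContDiffAt ℝ ∞ (c k) y) (hv : ∀ k, ContDiffAt ℝ ∞ (v k) y) (i : Fin n) :
    pder i (fun z => ∑ k, c k z • v k z) y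
      = ∑ k, (c k y • pder i (v k) y + pder i (c k) y • v k y) := by
  unfold pder
  have hc' := fun k => (hc k).differentiableAt (by simp)
  have hv' := fun k => (hv k).differentiableAt (by simp)
  rw [fderiv_fun_sum fun k _ => (hc' k).fun_smul (hv' k)]
  simp only [sum_apply]
  refine Finset.sum_congr rfl fun k _ => ?_
  rw [fderiv_fun_smul (hc' k) (hv' k)]
  simp

theorem pder_sub_sum_smul {f : Euc n → V} {c : Fin n → Euc n → ℝ} {v : Fin n → Euc n → V}
    {y : Euc n} (hf : ContDiffAt ℝ ∞ f y) (hc : ∀ k, ContDiffAt ℝ ∞ (c k) y)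
    (hv : ∀ k, ContDiffAt ℝ ∞ (v k) y) (i : Fin n) :
    pder i (fun z => f z - ∑ k, c k z • v k z) y
      = pder i f y - ∑ k, (c k y • pder i (v k) y + pder i (c k) y • v k y) := by
  rw [← pder_sum_smul hc hv]
  unfold pder
  have hs : ContDiffAt ℝ ∞ (fun z => ∑ k, c k z • v k z) y :=
    ContDiffAt.sum fun k _ => (hc k).smul (hv k)
  rw [fderiv_fun_sub (hf.differentiableAt (by simp)) (hs.differentiableAt (by simp))]
  simp

theorem pder_inner_eq_zero {f g : Euc n → V} {S : Set (Euc n)} (hS : IsOpen S)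
    (hf : ∀ y ∈ S, ContDiffAt ℝ ∞ f y) (hg : ∀ y ∈ S, ContDiffAt ℝ ∞ g y)
    (h : ∀ y ∈ S, (inner ℝ (f y) (g y) : ℝ) = 0) {y : Euc n} (hy : y ∈ S) (i : Fin n) :
    (inner ℝ (pder i f y) (g y) : ℝ) = -inner ℝ (f y) (pder i g y) := by
  have h1 := pder_inner (hf y hy) (hg y hy) i
  rw [pder_congr hS hy (g := fun _ => (0 : ℝ)) h] at h1
  simp only [pder, fderiv_fun_const, Pi.zero_apply, zero_apply] at h1
  simp only [pder]
  linarith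

theorem fderiv_eq_sum_pder (f : Euc n → V) (y a : Euc n) :
    fderiv ℝ f y a = ∑ i, a i • pder i f y := by
  have h : a = ∑ i, a i • EuclideanSpace.single i (1 : ℝ) := by
    simpa using ((EuclideanSpace.basisFun (Fin n) ℝ).sum_repr a).symm
  conv_lhs => rw [h]
  simp [pder]

/-- Against a normal vector, `h` and the raw second derivative are interchangeable, so products of
two values of `h` need only one of them projected. -/
theorem inner_paramSFF_of_orthogonal {F : Euc n → V} {y : Euc n} (i j : Fin n) {ξ : V}
    (hξ : ∀ q, (inner ℝ ξ (pder q F y) : ℝ) = 0) :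
    (inner ℝ ξ (paramSFF F i j y) : ℝ) = inner ℝ ξ (pder i (pder j F) y) := by
  simp [paramSFF, inner_sub_right, inner_sum, inner_smul_right, hξ]

namespace IsParam

variable {F : Euc n → V} {S : Set (Euc n)} (hF : IsParam F S)
include hF

theorem linearIndependent {y : Euc n} (hy : y ∈ S) :
    LinearIndependent ℝ (fun i => pder i F y) := by
  have h := (EuclideanSpace.basisFun (Fin n) ℝ).toBasis.linearIndependent.map'
    (fderiv ℝ F y : Euc n →ₗ[ℝ] V) (LinearMap.ker_eq_bot.mpr (hF.injective y hy))
  have h' : (fun i => pder i F y) = (fderiv ℝ F y : Euc n →ₗ[ℝ] V) ∘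
      (EuclideanSpace.basisFun (Fin n) ℝ).toBasis := by
    ext i
    simp [pder]
  rw [h']
  exact h

theorem contDiffAt_paramChristoffel {y : Euc n} (hy : y ∈ S) (k i j : Fin n) :
    ContDiffAt ℝ ∞ (paramChristoffel F k i j) y :=
  contDiffAt_frameCoeff (fun l => contDiffAt_pder (hF.smooth y hy) l)
    (contDiffAt_pder (contDiffAt_pder (hF.smooth y hy) j) i) (hF.linearIndependent hy) k

theorem contDiffAt_tanCoeff {y : Euc n} (hy : y ∈ S) (k : Fin n) :
    ContDiffAt ℝ ∞ (tanCoeff F k) y :=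
  contDiffAt_frameCoeff (fun l => contDiffAt_pder (hF.smooth y hy) l)
    (hF.smooth y hy) (hF.linearIndependent hy) k

theorem contDiffAt_paramN {y : Euc n} (hy : y ∈ S) : ContDiffAt ℝ ∞ (paramN F) y :=
  (hF.smooth y hy).sub (ContDiffAt.sum fun k _ =>
    (hF.contDiffAt_tanCoeff hy k).smul (contDiffAt_pder (hF.smooth y hy) k))

theorem contDiffAt_paramSFF {y : Euc n} (hy : y ∈ S) (i j : Fin n) :
    ContDiffAt ℝ ∞ (paramSFF F i j) y :=
  (contDiffAt_pder (contDiffAt_pder (hF.smooth y hy) j) i).sub (ContDiffAt.sum fun k _ =>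
    (hF.contDiffAt_paramChristoffel hy k i j).smul (contDiffAt_pder (hF.smooth y hy) k))

theorem inner_paramN {y : Euc n} (hy : y ∈ S) (q : Fin n) :
    (inner ℝ (paramN F y) (pder q F y) : ℝ) = 0 :=
  inner_sub_sum_frameCoeff (hF.linearIndependent hy) _ q

theorem inner_paramSFF {y : Euc n} (hy : y ∈ S) (i j q : Fin n) :
    (inner ℝ (paramSFF F i j y) (pder q F y) : ℝ) = 0 :=
  inner_sub_sum_frameCoeff (hF.linearIndependent hy) _ q

theorem inner_pder_pder {y : Euc n} (hy : y ∈ S) (i j q : Fin n) :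
    (inner ℝ (pder i (pder j F) y) (pder q F y) : ℝ)
      = ∑ l, paramChristoffel F l i j y * inner ℝ (pder l F y) (pder q F y) := by
  rw [← inner_sum_frameCoeff (hF.linearIndependent hy) (pder i (pder j F) y) q, sum_inner]
  simp only [inner_smul_left]
  rfl

theorem pder_pder_pder_comm {y : Euc n} (hy : y ∈ S) (i j k : Fin n) :
    pder i (pder j (pder k F)) y = pder i (pder k (pder j F)) y :=
  pder_congr hF.isOpen hy (fun z hz => pder_comm (hF.smooth z hz) j k) i

/-- Split `∂ⱼ∂ₖF` into `h` and its tangential part before applying `∂ᵢ`. The derivative falling on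
`h` moves to the other factor because `⟨h, ∂_qF⟩ = 0`. The tangential part yields the half of the
curvature expression that is to be antisymmetrized in `i` and `j`. -/
theorem inner_pder_pder_pder {y : Euc n} (hy : y ∈ S) (i j k q : Fin n) :
    (inner ℝ (pder i (pder j (pder k F)) y) (pder q F y) : ℝ)
      = -inner ℝ (paramSFF F j k y) (pder i (pder q F) y)
        + ∑ l, (pder i (paramChristoffel F l j k) y
          + ∑ a, paramChristoffel F l i a y * paramChristoffel F a j k y)
            * inner ℝ (pder l F y) (pder q F y) := by
  have h1 : pder i (pder j (pder k F)) y = pder i (paramSFF F j k) y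
      + ∑ a, (paramChristoffel F a j k y • pder i (pder a F) y
        + pder i (paramChristoffel F a j k) y • pder a F y) := by
    rw [← sub_eq_iff_eq_add]
    exact (pder_sub_sum_smul (contDiffAt_pder (contDiffAt_pder (hF.smooth y hy) k) j)
      (fun a => hF.contDiffAt_paramChristoffel hy a j k)
      (fun a => contDiffAt_pder (hF.smooth y hy) a) i).symm
  have h2 := pder_inner_eq_zero hF.isOpen (fun z hz => hF.contDiffAt_paramSFF hz j k)
    (fun z hz => contDiffAt_pder (hF.smooth z hz) q) (fun z hz => hF.inner_paramSFF hz j k q) hy i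
  rw [h1, inner_add_left, h2, sum_inner]
  congr 1
  simp only [inner_add_left, inner_smul_left, hF.inner_pder_pder hy, conj_trivial,
    Finset.sum_add_distrib, add_mul, Finset.mul_sum, Finset.sum_mul]
  rw [add_comm, Finset.sum_comm]
  congr 1
  refine Finset.sum_congr rfl fun l _ => Finset.sum_congr rfl fun a _ => ?_
  ring

/-- The Gauss equation. -/
theorem gauss {y : Euc n} (hy : y ∈ S) (i j k q : Fin n) :
    ∑ l, paramCurv F l i j k y * (inner ℝ (pder l F y) (pder q F y) : ℝ)
      = inner ℝ (paramSFF F j k y) (pder i (pder q F) y)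
        - inner ℝ (paramSFF F i k y) (pder j (pder q F) y) := by
  have h1 := hF.inner_pder_pder_pder hy i j k q
  have h2 := hF.inner_pder_pder_pder hy j i k q
  -- Third derivatives of `F` commute, so the two expansions agree; their difference is the Gauss
  -- equation.
  rw [pder_comm (contDiffAt_pder (hF.smooth y hy) k) i j, h2] at h1
  have h3 : ∑ l, paramCurv F l i j k y * (inner ℝ (pder l F y) (pder q F y) : ℝ)
      = ∑ l, (pder i (paramChristoffel F l j k) y
          + ∑ a, paramChristoffel F l i a y * paramChristoffel F a j k y)
            * inner ℝ (pder l F y) (pder q F y)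
        - ∑ l, (pder j (paramChristoffel F l i k) y
          + ∑ a, paramChristoffel F l j a y * paramChristoffel F a i k y)
            * inner ℝ (pder l F y) (pder q F y) := by
    rw [← Finset.sum_sub_distrib]
    refine Finset.sum_congr rfl fun l _ => ?_
    rw [paramCurv, Finset.sum_sub_distrib]
    ring
  linarith

/-- The normal component of `∂ᵢN = ∂ᵢF - ∂ᵢT` is `-h(∂ᵢ, T)`: terms along `∂ₖF` are invisible to the
normal vector `ξ`. -/
theorem inner_pder_paramN {y : Euc n} (hy : y ∈ S) (i : Fin n) {ξ : V}
    (hξ : ∀ q, (inner ℝ ξ (pder q F y) : ℝ) = 0) :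
    (inner ℝ ξ (pder i (paramN F) y) : ℝ)
      = -∑ k, tanCoeff F k y * inner ℝ ξ (pder i (pder k F) y) := by
  have h1 : pder i (paramN F) y = pder i F y
      - ∑ k, (tanCoeff F k y • pder i (pder k F) y + pder i (tanCoeff F k) y • pder k F y) :=
    pder_sub_sum_smul (hF.smooth y hy) (fun a => hF.contDiffAt_tanCoeff hy a)
      (fun a => contDiffAt_pder (hF.smooth y hy) a) i
  simp [h1, inner_sub_right, inner_sum, inner_add_right, inner_smul_right, hξ]

/-! ### Consequences of the rectifying condition in a parametrization -/

section Rectifying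

variable (hrect : ∀ y ∈ S, ∀ i j, (inner ℝ (paramN F y) (pder i (pder j F) y) : ℝ) = 0)
include hrect

theorem inner_pder_paramN_pder {y : Euc n} (hy : y ∈ S) (i q : Fin n) :
    (inner ℝ (pder i (paramN F) y) (pder q F y) : ℝ) = 0 := by
  rw [pder_inner_eq_zero hF.isOpen (fun z hz => hF.contDiffAt_paramN hz)
    (fun z hz => contDiffAt_pder (hF.smooth z hz) q) (fun z hz => hF.inner_paramN hz q) hy i,
    hrect y hy, neg_zero]

theorem inner_paramN_pder_paramN {y : Euc n} (hy : y ∈ S) (i : Fin n) :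
    (inner ℝ (paramN F y) (pder i (paramN F) y) : ℝ) = 0 := by
  rw [hF.inner_pder_paramN hy i (hF.inner_paramN hy)]
  simp [hrect y hy]

/-- Differentiating the rectifying condition gives `-⟨N, ∂_q∂ⱼ∂ₖF⟩` on the left, which is symmetric
in all three indices. -/
theorem inner_pder_paramN_pder_pder {y : Euc n} (hy : y ∈ S) (q j k : Fin n) :
    (inner ℝ (pder q (paramN F) y) (pder j (pder k F) y) : ℝ)
      = inner ℝ (pder k (paramN F) y) (pder j (pder q F) y) := by
  have h := fun j k q => pder_inner_eq_zero hF.isOpen (fun z hz => hF.contDiffAt_paramN hz)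
    (fun z hz => contDiffAt_pder (contDiffAt_pder (hF.smooth z hz) k) j)
    (fun z hz => hrect z hz j k) hy q
  rw [h, h, hF.pder_pder_pder_comm hy q j k, pder_comm (contDiffAt_pder (hF.smooth y hy) j) q k,
    hF.pder_pder_pder_comm hy k q j]

/-- The curvature of a rectifying submanifold in the direction of the tangential part of the
position vector vanishes. -/
theorem sum_tanCoeff_mul_paramCurv {y : Euc n} (hy : y ∈ S) (j k q : Fin n) :
    ∑ i, tanCoeff F i y * ∑ l, paramCurv F l i j k y * (inner ℝ (pder l F y) (pder q F y) : ℝ)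
      = 0 := by
  have hN := hF.inner_pder_paramN_pder hrect hy
  -- This is `⟨h(∂_a, ∂_b), h(T, ∂_c)⟩`, and `h(T, ∂_c) = -∂_cN` because `∂_cN` is normal.
  have key : ∀ a b c : Fin n, ∑ i, tanCoeff F i y *
      (inner ℝ (paramSFF F a b y) (pder i (pder c F) y) : ℝ)
        = -inner ℝ (pder c (paramN F) y) (pder a (pder b F) y) := fun a b c => by
    have h := hF.inner_pder_paramN hy c (hF.inner_paramSFF hy a b)
    rw [real_inner_comm, inner_paramSFF_of_orthogonal a b (hN c)] at h
    rw [h, neg_neg]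
    exact Finset.sum_congr rfl fun i _ => by rw [pder_comm (hF.smooth y hy) i c]
  -- Both sides equal `⟨h(∂ᵢ, ∂ₖ), h(∂ⱼ, ∂_q)⟩`; the form on the right lets `key` sum over `i`.
  have h2 : ∀ i, (inner ℝ (paramSFF F i k y) (pder j (pder q F) y) : ℝ)
      = inner ℝ (paramSFF F j q y) (pder i (pder k F) y) := fun i => by
    rw [← inner_paramSFF_of_orthogonal j q (hF.inner_paramSFF hy i k), real_inner_comm,
      inner_paramSFF_of_orthogonal i k (hF.inner_paramSFF hy j q)]
  simp only [hF.gauss hy, h2, mul_sub, Finset.sum_sub_distrib, key]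
  rw [hF.inner_pder_paramN_pder_pder hrect hy q j k, sub_self]

end Rectifying

end IsParam

end Param

/-! ### Submanifolds of Euclidean space in charts -/

section Chart

variable {n m : ℕ} {M : Type*} [TopologicalSpace M] [ChartedSpace (Euc n) M]

/-- The map `x` in the chart at `p`. -/
def inChart {V : Type*} (x : M → V) (p : M) (y : Euc n) : V := x ((extChartAt (𝓡 n) p).symm y)

theorem extChartAt_symm_self (p : M) :
    (extChartAt (𝓡 n) p).symm (extChartAt (𝓡 n) p p) = p :=
  (extChartAt (𝓡 n) p).left_inv (mem_extChartAt_source p)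

variable [IsManifold (𝓡 n) ∞ M]

theorem contMDiffAt_extChartAt_symm {p : M} {y : Euc n} (hy : y ∈ (extChartAt (𝓡 n) p).target) :
    ContMDiffAt 𝓘(ℝ, Euc n) (𝓡 n) ∞ (extChartAt (𝓡 n) p).symm y :=
  (contMDiffOn_extChartAt_symm p).contMDiffAt ((isOpen_extChartAt_target p).mem_nhds hy)

theorem mdifferentiableAt_extChartAt_symm {p : M} {y : Euc n}
    (hy : y ∈ (extChartAt (𝓡 n) p).target) :
    MDifferentiableAt 𝓘(ℝ, Euc n) (𝓡 n) (extChartAt (𝓡 n) p).symm y :=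
  (contMDiffAt_extChartAt_symm hy).mdifferentiableAt (by simp)

theorem isInvertible_mfderiv_extChartAt_symm {p : M} {y : Euc n}
    (hy : y ∈ (extChartAt (𝓡 n) p).target) :
    (mfderiv 𝓘(ℝ, Euc n) (𝓡 n) (extChartAt (𝓡 n) p).symm y).IsInvertible := by
  have h := isInvertible_mfderivWithin_extChartAt_symm (I := 𝓡 n) hy
  rwa [ModelWithCorners.range_eq_univ, mfderivWithin_univ] at h

section Map

variable {V : Type*} [NormedAddCommGroup V] [NormedSpace ℝ V] {x : M → V} {p : M}

theorem contDiffAt_inChart {y : Euc n} (hy : y ∈ (extChartAt (𝓡 n) p).target)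
    (hx : ContMDiffAt (𝓡 n) 𝓘(ℝ, V) ∞ x ((extChartAt (𝓡 n) p).symm y)) :
    ContDiffAt ℝ ∞ (inChart x p) y :=
  (hx.comp y (contMDiffAt_extChartAt_symm hy)).contDiffAt

theorem fderiv_inChart {y : Euc n} (hy : y ∈ (extChartAt (𝓡 n) p).target)
    (hx : MDifferentiableAt (𝓡 n) 𝓘(ℝ, V) x ((extChartAt (𝓡 n) p).symm y)) (a : Euc n) :
    fderiv ℝ (inChart x p) y a = mvfderiv (𝓡 n) x ((extChartAt (𝓡 n) p).symm y)
      (mfderiv 𝓘(ℝ, Euc n) (𝓡 n) (extChartAt (𝓡 n) p).symm y a) := by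
  have h := mfderiv_comp_apply y hx (mdifferentiableAt_extChartAt_symm hy) a
  rw [← mfderiv_eq_fderiv]
  exact h

theorem fderiv_inChart_coords (hx : MDifferentiableAt (𝓡 n) 𝓘(ℝ, V) x p)
    (v : TangentSpace (𝓡 n) p) :
    fderiv ℝ (inChart x p) (extChartAt (𝓡 n) p p) (coords p v) = mvfderiv (𝓡 n) x p v := by
  have hd : MDifferentiableAt 𝓘(ℝ, Euc n) 𝓘(ℝ, V) (inChart x p) (extChartAt (𝓡 n) p p) :=
    MDifferentiableAt.comp_of_eq _ hx
      (mdifferentiableAt_extChartAt_symm (mem_extChartAt_target p)) (extChartAt_symm_self p)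
  have h := mfderiv_comp_apply p hd
    (mdifferentiableAt_extChartAt (I := 𝓡 n) (mem_chart_source (Euc n) p)) v
  have he : inChart x p ∘ extChartAt (𝓡 n) p =ᶠ[nhds p] x := by
    filter_upwards [extChartAt_source_mem_nhds (I := 𝓡 n) p] with z hz
    exact congrArg x ((extChartAt (𝓡 n) p).left_inv hz)
  rw [← mfderiv_eq_fderiv]
  have h2 : mfderiv (𝓡 n) 𝓘(ℝ, V) (inChart x p ∘ extChartAt (𝓡 n) p) p v
    = mvfderiv (𝓡 n) x p v := by rw [he.mfderiv_eq]; rfl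
  exact (h2.symm.trans h).symm

/-- A map that is differentiable in the chart at `p` is differentiable at `p`. -/
theorem mdifferentiableAt_of_inChart {f : Euc n → V}
    (hf : DifferentiableAt ℝ f (extChartAt (𝓡 n) p p))
    (h : ∀ y ∈ (extChartAt (𝓡 n) p).target, inChart x p y = f y) :
    MDifferentiableAt (𝓡 n) 𝓘(ℝ, V) x p := by
  have hd : MDifferentiableAt (𝓡 n) 𝓘(ℝ, V) (f ∘ extChartAt (𝓡 n) p) p :=
    hf.mdifferentiableAt.comp p
      (mdifferentiableAt_extChartAt (I := 𝓡 n) (mem_chart_source (Euc n) p))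
  refine hd.congr_of_eventuallyEq ?_
  filter_upwards [extChartAt_source_mem_nhds (I := 𝓡 n) p] with z hz
  have := h _ ((extChartAt (𝓡 n) p).map_source hz)
  simp only [inChart, (extChartAt (𝓡 n) p).left_inv hz] at this
  exact this

end Map

theorem coords_surjective (p : M) : Function.Surjective (coords (n := n) p) := by
  obtain ⟨e, he⟩ := isInvertible_mfderiv_extChartAt (I := 𝓡 n) (mem_extChartAt_source p)
  intro a
  refine ⟨e.symm a, ?_⟩
  change mfderiv (𝓡 n) 𝓘(ℝ, Euc n) (extChartAt (𝓡 n) p) p (e.symm a) = a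
  rw [← he]
  exact e.apply_symm_apply a

theorem contDiffAt_transition {p : M} {y : Euc n} (hy : y ∈ (extChartAt (𝓡 n) p).target) :
    ContDiffAt ℝ ∞ (inChart (extChartAt (𝓡 n) ((extChartAt (𝓡 n) p).symm y)) p) y :=
  contDiffAt_inChart hy contMDiffAt_extChartAt

/-- The second-order chain rule: the correction term is `DG` applied to the second derivative of
`τ`. It is tangent, so pairing with a normal vector kills it, which makes `h` independent of the
chart. -/
theorem exists_fderiv_fderiv_comp {E E' V : Type*} [NormedAddCommGroup E] [NormedSpace ℝ E]
    [NormedAddCommGroup E'] [NormedSpace ℝ E'] [NormedAddCommGroup V] [NormedSpace ℝ V]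
    {G : E' → V} {τ : E → E'} {y : E} (hG : ContDiffAt ℝ ∞ G (τ y)) (hτ : ContDiffAt ℝ ∞ τ y)
    (a b : E) :
    ∃ c, fderiv ℝ (fun z => fderiv ℝ (fun z => G (τ z)) z b) y a
      = fderiv ℝ (fun z => fderiv ℝ G z (fderiv ℝ τ y b)) (τ y) (fderiv ℝ τ y a)
        + fderiv ℝ G (τ y) c := by
  have hG' : DifferentiableAt ℝ (fderiv ℝ G) (τ y) :=
    (hG.fderiv_right (m := ∞) (by simp)).differentiableAt (by simp)
  have hτ' : DifferentiableAt ℝ (fderiv ℝ τ) y :=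
    (hτ.fderiv_right (m := ∞) (by simp)).differentiableAt (by simp)
  have hτd : DifferentiableAt ℝ τ y := hτ.differentiableAt (by simp)
  have h1 : (fun z => fderiv ℝ (fun z => G (τ z)) z b)
      =ᶠ[nhds y] fun z => fderiv ℝ G (τ z) (fderiv ℝ τ z b) := by
    have e1 : ∀ᶠ z in nhds y, ContDiffAt ℝ 1 τ z :=
      (hτ.of_le (by simp)).eventually (by simp)
    have e2 : ∀ᶠ z in nhds y, ContDiffAt ℝ 1 G (τ z) :=
      hτ.continuousAt.eventually ((hG.of_le (by simp)).eventually (by simp))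
    filter_upwards [e1, e2] with z h1 h2
    have := fderiv_comp z (h2.differentiableAt (by simp)) (h1.differentiableAt (by simp))
    exact congrArg (fun A => A b) this
  refine ⟨fderiv ℝ (fun z => fderiv ℝ τ z b) y a, ?_⟩
  have hGτ : DifferentiableAt ℝ (fun z => fderiv ℝ G (τ z)) y := hG'.comp y hτd
  have h2 : fderiv ℝ (fun z => fderiv ℝ G (τ z)) y a
      = fderiv ℝ (fderiv ℝ G) (τ y) (fderiv ℝ τ y a) :=
    congrArg (fun A => A a) (fderiv_comp y hG' hτd)
  rw [h1.fderiv_eq, fderiv_clm_apply hGτ (hτ'.clm_apply (differentiableAt_const b)),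
    fderiv_clm_apply hG' (differentiableAt_const _)]
  simp [h2, add_comm]

end Chart

/-! ### Intrinsic and parametric quantities of an isometric immersion -/

section Isometric

variable {n m : ℕ} {M : Type*} [TopologicalSpace M] [ChartedSpace (Euc n) M]
  {x : M → Euc m}

theorem inner_normalPart_comm (p : M) (v w : Euc m) :
    (inner ℝ (normalPart n x p v) w : ℝ) = inner ℝ v (normalPart n x p w) := by
  simp only [normalPart, tangentPart, inner_sub_left, inner_sub_right,
    Submodule.inner_starProjection_left_eq_right]

theorem inner_posN_mvfderiv (p : M) (v : TangentSpace (𝓡 n) p) :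
    (inner ℝ (posN n x p) (mvfderiv (𝓡 n) x p v) : ℝ) = 0 :=
  Submodule.starProjection_inner_eq_zero (K := tangentImage n x p) _ _ ⟨v, rfl⟩

variable [RiemannianBundle (fun p : M => TangentSpace (𝓡 n) p)] (hx : IsIsometricImmersion n x)
include hx

theorem IsIsometricImmersion.mdifferentiableAt (p : M) :
    MDifferentiableAt (𝓡 n) 𝓘(ℝ, Euc m) x p :=
  (hx.1 p).mdifferentiableAt (by simp)

theorem IsIsometricImmersion.injective (p : M) :
    Function.Injective (mvfderiv (𝓡 n) x p) := by
  rw [injective_iff_map_eq_zero]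
  intro v hv
  have h := hx.2 p v v
  rw [hv, inner_zero_left] at h
  exact inner_self_eq_zero.mp h.symm

variable [IsManifold (𝓡 n) ∞ M]

theorem IsIsometricImmersion.isParam (p : M) :
    IsParam (inChart x p) (extChartAt (𝓡 n) p).target where
  isOpen := isOpen_extChartAt_target p
  smooth y hy := contDiffAt_inChart hy (hx.1 _)
  injective y hy := by
    obtain ⟨e, he⟩ := isInvertible_mfderiv_extChartAt_symm hy
    intro a b hab
    rw [fderiv_inChart hy (hx.mdifferentiableAt _), fderiv_inChart hy (hx.mdifferentiableAt _)]
      at hab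
    have h := hx.injective _ hab
    rw [← he] at h
    exact e.injective h

theorem IsIsometricImmersion.metricMatrix_eq {p : M} {y : Euc n}
    (hy : y ∈ (extChartAt (𝓡 n) p).target) :
    metricMatrix p y = Matrix.gram ℝ (fun i => pder i (inChart x p) y) := by
  ext i j
  rw [Matrix.gram_apply, pder, pder, fderiv_inChart hy (hx.mdifferentiableAt _),
    fderiv_inChart hy (hx.mdifferentiableAt _), hx.2]
  rfl

/-- By the product rule for `⟨∂_bF, ∂_cF⟩` and symmetry of second derivatives, the three metric
derivatives collapse to `2⟨∂ᵢ∂ⱼF, ∂_lF⟩`. The Levi-Civita connection is thus the tangential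
projection of the flat one. -/
theorem IsIsometricImmersion.christoffel_eq {p : M} {y : Euc n}
    (hy : y ∈ (extChartAt (𝓡 n) p).target) (k i j : Fin n) :
    christoffel p k i j y = paramChristoffel (inChart x p) k i j y := by
  have hF := hx.isParam p
  have hd : ∀ a b c, partialD a (fun z => metricMatrix p z b c) y
      = inner ℝ (pder b (inChart x p) y) (pder a (pder c (inChart x p)) y)
        + inner ℝ (pder a (pder b (inChart x p)) y) (pder c (inChart x p) y) := fun a b c => by
    rw [← pder_inner (contDiffAt_pder (hF.smooth y hy) b) (contDiffAt_pder (hF.smooth y hy) c)]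
    exact pder_congr hF.isOpen hy (fun z hz => by rw [hx.metricMatrix_eq hz, Matrix.gram_apply]) a
  rw [christoffel, paramChristoffel, frameCoeff, Finset.mul_sum, hx.metricMatrix_eq hy]
  refine Finset.sum_congr rfl fun l _ => ?_
  have hc := pder_comm (hF.smooth y hy)
  rw [hd, hd, hd, hc j l, hc i l, hc j i,
    real_inner_comm (pder l (pder i (inChart x p)) y),
    real_inner_comm (pder l (pder j (inChart x p)) y)]
  ring

theorem IsIsometricImmersion.curvCoeff_eq {p : M} {y : Euc n}
    (hy : y ∈ (extChartAt (𝓡 n) p).target) (l i j k : Fin n) :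
    curvCoeff p l i j k y = paramCurv (inChart x p) l i j k y := by
  have hF := hx.isParam p
  have hd : ∀ a b c d, partialD a (christoffel p b c d) y
      = pder a (paramChristoffel (inChart x p) b c d) y := fun a b c d =>
    pder_congr hF.isOpen hy (fun z hz => hx.christoffel_eq hz b c d) a
  simp only [curvCoeff, paramCurv, hd, hx.christoffel_eq hy]

theorem IsIsometricImmersion.posT_eq {p : M} {y : Euc n}
    (hy : y ∈ (extChartAt (𝓡 n) p).target) :
    posT n x ((extChartAt (𝓡 n) p).symm y)
      = ∑ k, tanCoeff (inChart x p) k y • pder k (inChart x p) y := by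
  have hF := hx.isParam p
  refine Submodule.eq_starProjection_of_mem_of_inner_eq_zero ?_ ?_
  · refine Submodule.sum_mem _ fun k _ => Submodule.smul_mem _ _ ?_
    exact ⟨_, (fderiv_inChart hy (hx.mdifferentiableAt _) _).symm⟩
  · rintro _ ⟨u, rfl⟩
    obtain ⟨e, he⟩ := isInvertible_mfderiv_extChartAt_symm hy
    obtain ⟨a, hu⟩ : ∃ a : Euc n, mvfderiv (𝓡 n) x ((extChartAt (𝓡 n) p).symm y) u
        = fderiv ℝ (inChart x p) y a := by
      refine ⟨e.symm u, ?_⟩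
      refine Eq.trans ?_ (fderiv_inChart hy (hx.mdifferentiableAt _) _).symm
      rw [← he]
      exact congrArg _ (e.apply_symm_apply u).symm
    have h : ∀ q, (inner ℝ (x ((extChartAt (𝓡 n) p).symm y)
        - ∑ k, tanCoeff (inChart x p) k y • pder k (inChart x p) y)
          (pder q (inChart x p) y) : ℝ) = 0 := hF.inner_paramN hy
    rw [ContinuousLinearMap.coe_coe, hu, fderiv_eq_sum_pder, inner_sum]
    exact Finset.sum_eq_zero fun q _ => by rw [inner_smul_right, h, mul_zero]

theorem IsIsometricImmersion.posN_eq {p : M} {y : Euc n}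
    (hy : y ∈ (extChartAt (𝓡 n) p).target) :
    inChart (posN n x) p y = paramN (inChart x p) y := by
  have h := hx.posT_eq hy
  rw [paramN, ← h]
  rfl

/-- The second fundamental form of a rectifying submanifold is orthogonal to the normal part of the
position vector in every chart. -/
theorem IsIsometricImmersion.inner_paramN_pder_pder (hrect : IsRectifying n x) {p : M} {y : Euc n}
    (hy : y ∈ (extChartAt (𝓡 n) p).target) (i j : Fin n) :
    (inner ℝ (paramN (inChart x p) y) (pder i (pder j (inChart x p)) y) : ℝ) = 0 := by
  have hq := hx.posN_eq hy
  rw [← hq]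
  -- `secondFF` at `q` is computed in the chart at `q`, whereas the derivatives here are taken in
  -- the chart at `p`; `τ` below is the transition between them.
  set q := (extChartAt (𝓡 n) p).symm y with hqdef
  change inner ℝ (posN n x q) _ = 0
  have hτ := contDiffAt_transition hy
  rw [← hqdef] at hτ
  set τ : Euc n → Euc n := inChart (n := n) (extChartAt (𝓡 n) q) p
  have hτy : τ y = extChartAt (𝓡 n) q q := rfl
  have hG : ContDiffAt ℝ ∞ (inChart x q) (τ y) := by
    rw [hτy]
    exact (hx.isParam q).smooth _ (mem_extChartAt_target q)
  have hnear : ∀ᶠ z in nhds y, inChart x p z = inChart x q (τ z) := by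
    have hc : ContinuousAt (extChartAt (𝓡 n) p).symm y :=
      (contMDiffAt_extChartAt_symm hy).continuousAt
    filter_upwards [hc.preimage_mem_nhds (extChartAt_source_mem_nhds (I := 𝓡 n) q)] with z hz
    change _ = x ((extChartAt (𝓡 n) q).symm (extChartAt (𝓡 n) q ((extChartAt (𝓡 n) p).symm z)))
    rw [(extChartAt (𝓡 n) q).left_inv hz]
    rfl
  have hpd : pder i (pder j (inChart x p)) y = fderiv ℝ (fun z => fderiv ℝ
      (fun z => inChart x q (τ z)) z (EuclideanSpace.single j 1)) y
        (EuclideanSpace.single i 1) := by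
    have h : pder j (inChart x p) =ᶠ[nhds y] fun z => fderiv ℝ
      (fun z => inChart x q (τ z)) z (EuclideanSpace.single j 1) := by
      filter_upwards [hnear.eventually_nhds] with z hz
      have hz' : inChart x p =ᶠ[nhds z] fun z => inChart x q (τ z) := hz
      rw [pder, hz'.fderiv_eq]
    rw [pder, h.fderiv_eq]
  obtain ⟨c, hc⟩ := exists_fderiv_fderiv_comp hG hτ
    (EuclideanSpace.single i (1 : ℝ)) (EuclideanSpace.single j (1 : ℝ))
  obtain ⟨v, hv⟩ := coords_surjective q (fderiv ℝ τ y (EuclideanSpace.single i (1 : ℝ)))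
  obtain ⟨w, hw⟩ := coords_surjective q (fderiv ℝ τ y (EuclideanSpace.single j (1 : ℝ)))
  obtain ⟨u, hu⟩ := coords_surjective q c
  rw [hpd, hc, ← hv, ← hw, ← hu, hτy, fderiv_inChart_coords (hx.mdifferentiableAt q),
    inner_add_right, inner_posN_mvfderiv, add_zero]
  refine (inner_normalPart_comm q _ _).trans ?_
  rw [real_inner_comm]
  exact (Submodule.mem_orthogonal _ _).mp (hrect q) _ (Submodule.subset_span ⟨v, w, rfl⟩)

end Isometric

/-! ### Functions with vanishing differential -/

section Constant

variable {n : ℕ} {M : Type*} [TopologicalSpace M] [ChartedSpace (Euc n) M]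
  [IsManifold (𝓡 n) ∞ M]

/-- A function with vanishing differential is constant on preconnected open sets. -/
theorem eq_of_mvfderiv_eq_zero {f : M → ℝ} {U : Set M} (hU : IsOpen U) (hc : IsPreconnected U)
    (hf : ∀ q ∈ U, MDifferentiableAt (𝓡 n) 𝓘(ℝ, ℝ) f q)
    (hd : ∀ q ∈ U, ∀ v, mvfderiv (𝓡 n) f q v = 0) {p q : M} (hp : p ∈ U) (hq : q ∈ U) :
    f p = f q := by
  have hloc : ∀ q ∈ U, ∀ᶠ z in nhds q, f z = f q := by
    intro q hq
    have hS : IsOpen ((extChartAt (𝓡 n) q).target ∩ (extChartAt (𝓡 n) q).symm ⁻¹' U) :=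
      (continuousOn_extChartAt_symm q).isOpen_inter_preimage (isOpen_extChartAt_target q) hU
    -- Where the derivative vanishes, level sets are open; this makes `f` locally constant on `U`.
    have h := hS.isOpen_inter_preimage_of_fderiv_eq_zero (f := inChart (n := n) f q) (𝕜 := ℝ)
      (fun y hy => (((hf _ hy.2).comp y
        (mdifferentiableAt_extChartAt_symm hy.1)).differentiableAt).differentiableWithinAt)
      (fun y hy => by
        ext a
        exact (fderiv_inChart hy.1 (hf _ hy.2) a).trans (hd _ hy.2 _)) {f q}
    have hmem : extChartAt (𝓡 n) q q ∈ ((extChartAt (𝓡 n) q).target ∩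
        (extChartAt (𝓡 n) q).symm ⁻¹' U) ∩ inChart (n := n) f q ⁻¹' {f q} := by
      refine ⟨⟨mem_extChartAt_target q, ?_⟩, ?_⟩
      · rw [Set.mem_preimage, extChartAt_symm_self]
        exact hq
      · exact congrArg f (extChartAt_symm_self q)
    filter_upwards [(continuousAt_extChartAt (I := 𝓡 n) q).preimage_mem_nhds (h.mem_nhds hmem),
      extChartAt_source_mem_nhds (I := 𝓡 n) q] with z hz hz'
    have h2 : inChart (n := n) f q (extChartAt (𝓡 n) q z) = f q := hz.2
    rw [← h2]
    exact (congrArg f ((extChartAt (𝓡 n) q).left_inv hz')).symm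
  have : PreconnectedSpace U := isPreconnected_iff_preconnectedSpace.mp hc
  have hlc : IsLocallyConstant (U.domRestrict f) := by
    rw [IsLocallyConstant.iff_eventually_eq]
    intro z
    exact continuous_subtype_val.continuousAt.eventually (hloc z z.2)
  exact hlc.apply_eq_of_preconnectedSpace ⟨p, hp⟩ ⟨q, hq⟩

end Constant

/-! ### The position vector field and its tangential and normal parts -/

section Position

variable {n m : ℕ} {M : Type*} [TopologicalSpace M] [ChartedSpace (Euc n) M] {x : M → Euc m}

theorem mvfderiv_tangentVec (p : M) (v : Euc m) :
    mvfderiv (𝓡 n) x p (tangentVec n x p v) = tangentPart n x p v :=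
  (exists_mvfderiv_eq_tangentPart n x p v).choose_spec

theorem inner_posT_mvfderiv (p : M) (v : TangentSpace (𝓡 n) p) :
    (inner ℝ (posT n x p) (mvfderiv (𝓡 n) x p v) : ℝ) = inner ℝ (x p) (mvfderiv (𝓡 n) x p v) := by
  have h := inner_posN_mvfderiv (x := x) p v
  rw [posN, normalPart, inner_sub_left, sub_eq_zero] at h
  exact h.symm

theorem norm_sq_eq_add (p : M) : ‖x p‖ ^ 2 = ‖posT n x p‖ ^ 2 + ‖posN n x p‖ ^ 2 := by
  have h : x p = posT n x p + posN n x p := by simp [posN, normalPart, posT]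
  have h0 : (inner ℝ (posT n x p) (posN n x p) : ℝ) = 0 := by
    rw [real_inner_comm, posT, ← mvfderiv_tangentVec]
    exact inner_posN_mvfderiv p _
  conv_lhs => rw [h]
  rw [norm_add_sq_real, h0]
  ring

theorem IsProperRectifying.norm_posT_pos (hrect : IsProperRectifying n x) (p : M) :
    0 < ‖posT n x p‖ := by
  refine norm_pos_iff.mpr fun h => (hrect.2 p).2 ?_
  rw [posN, normalPart]
  change x p = x p - posT n x p
  rw [h, sub_zero]

variable [RiemannianBundle (fun p : M => TangentSpace (𝓡 n) p)]

theorem IsIsometricImmersion.norm_posTVec (hx : IsIsometricImmersion n x) (p : M) :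
    ‖posTVec n x p‖ = ‖posT n x p‖ := by
  have h := hx.2 p (posTVec n x p) (posTVec n x p)
  rw [posTVec, mvfderiv_tangentVec] at h
  rw [← sq_eq_sq₀ (norm_nonneg _) (norm_nonneg _), ← real_inner_self_eq_norm_sq,
    ← real_inner_self_eq_norm_sq]
  exact h.symm

theorem IsIsometricImmersion.inner_unitT_self (hx : IsIsometricImmersion n x)
    (hrect : IsProperRectifying n x) (p : M) :
    (inner ℝ (unitT n x p) (unitT n x p) : ℝ) = 1 := by
  have h := (hrect.norm_posT_pos p).ne'
  rw [unitT, inner_smul_left, inner_smul_right, real_inner_self_eq_norm_sq, hx.norm_posTVec]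
  simp only [conj_trivial]
  field_simp

/-- Splitting `v` along `e₁` and its complement shows that the two conditions on `s` determine `ds`
completely. -/
theorem IsIsometricImmersion.mvfderiv_eq_inner_unitT (hx : IsIsometricImmersion n x)
    (hrect : IsProperRectifying n x) {U : Set M} {s : M → ℝ}
    (hs : IsArclengthCoord n x U s) {p : M} (hp : p ∈ U) (v : TangentSpace (𝓡 n) p) :
    mvfderiv (𝓡 n) s p v = inner ℝ (unitT n x p) v := by
  obtain ⟨h1, h2⟩ := hs.2 p hp
  have h3 := h2 (v - (inner ℝ (unitT n x p) v : ℝ) • unitT n x p) (by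
    rw [inner_sub_left, inner_smul_left, hx.inner_unitT_self hrect, real_inner_comm]
    simp)
  rw [map_sub, map_smul, h1, sub_eq_zero] at h3
  simpa using h3

variable [IsManifold (𝓡 n) ∞ M]

theorem IsIsometricImmersion.mdifferentiableAt_posN (hx : IsIsometricImmersion n x) (p : M) :
    MDifferentiableAt (𝓡 n) 𝓘(ℝ, Euc m) (posN n x) p :=
  mdifferentiableAt_of_inChart
    (((hx.isParam p).contDiffAt_paramN (mem_extChartAt_target p)).differentiableAt (by simp))
    fun _ hy => hx.posN_eq hy

theorem IsIsometricImmersion.mvfderiv_posN (hx : IsIsometricImmersion n x) (p : M)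
    (v : TangentSpace (𝓡 n) p) :
    mvfderiv (𝓡 n) (posN n x) p v
      = ∑ i, coords p v i • pder i (paramN (inChart x p)) (extChartAt (𝓡 n) p p) := by
  rw [← fderiv_inChart_coords (hx.mdifferentiableAt_posN p), fderiv_eq_sum_pder]
  exact Finset.sum_congr rfl fun i _ => by
    rw [pder_congr (hx.isParam p).isOpen (mem_extChartAt_target p) fun z hz => hx.posN_eq hz]

theorem IsIsometricImmersion.inner_posN_mvfderiv_posN (hx : IsIsometricImmersion n x)
    (hrect : IsRectifying n x) (p : M) (v : TangentSpace (𝓡 n) p) :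
    (inner ℝ (posN n x p) (mvfderiv (𝓡 n) (posN n x) p v) : ℝ) = 0 := by
  have hy := mem_extChartAt_target (I := 𝓡 n) p
  have hN : posN n x p = paramN (inChart x p) (extChartAt (𝓡 n) p p) := by
    rw [← hx.posN_eq hy, inChart, extChartAt_symm_self]
  rw [hx.mvfderiv_posN, hN, inner_sum]
  refine Finset.sum_eq_zero fun i _ => ?_
  rw [inner_smul_right, (hx.isParam p).inner_paramN_pder_paramN
    (fun _ hz => hx.inner_paramN_pder_pder hrect hz) hy, mul_zero]

/-- The shape operator in the direction of the normal part of the position vector vanishes. -/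
theorem IsIsometricImmersion.shapeOperator_posN (hx : IsIsometricImmersion n x)
    (hrect : IsRectifying n x) (p : M) (v : TangentSpace (𝓡 n) p) :
    shapeOperator n x (posN n x) p v = 0 := by
  have hy := mem_extChartAt_target (I := 𝓡 n) p
  have h : tangentPart n x p (mvfderiv (𝓡 n) (posN n x) p v) = 0 := by
    refine Submodule.eq_starProjection_of_mem_of_inner_eq_zero (zero_mem _) ?_
    rintro _ ⟨u, rfl⟩
    rw [sub_zero, hx.mvfderiv_posN, ContinuousLinearMap.coe_coe,
      ← fderiv_inChart_coords (hx.mdifferentiableAt p), fderiv_eq_sum_pder, sum_inner]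
    refine Finset.sum_eq_zero fun i _ => ?_
    rw [inner_sum]
    refine Finset.sum_eq_zero fun q _ => ?_
    rw [inner_smul_left, inner_smul_right, (hx.isParam p).inner_pder_paramN_pder
      (fun _ hz => hx.inner_paramN_pder_pder hrect hz) hy, mul_zero, mul_zero]
  rw [shapeOperator, neg_eq_zero]
  apply hx.injective p
  rw [mvfderiv_tangentVec, h, map_zero]

theorem IsIsometricImmersion.exists_norm_posN_eq [ConnectedSpace M]
    (hx : IsIsometricImmersion n x) (hrect : IsRectifying n x) :
    ∃ c : ℝ, ∀ p : M, ‖posN n x p‖ = c := by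
  obtain ⟨p₀⟩ := ConnectedSpace.toNonempty (α := M)
  refine ⟨‖posN n x p₀‖, fun p => ?_⟩
  have hg : ∀ w : Euc m, MDifferentiableAt 𝓘(ℝ, Euc m) 𝓘(ℝ, ℝ) (fun w : Euc m => ‖w‖ ^ 2) w :=
    fun w => (differentiableAt_id.norm_sq ℝ).mdifferentiableAt
  have h : ‖posN n x p‖ ^ 2 = ‖posN n x p₀‖ ^ 2 := by
    refine eq_of_mvfderiv_eq_zero (n := n) (f := fun p => ‖posN n x p‖ ^ 2) isOpen_univ
      isPreconnected_univ
      (fun q _ => (hg _).comp q (hx.mdifferentiableAt_posN q)) (fun q _ v => ?_)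
      (Set.mem_univ p) (Set.mem_univ p₀)
    have h1 := mfderiv_comp_apply q (hg _) (hx.mdifferentiableAt_posN q) v
    have h2 := hx.inner_posN_mvfderiv_posN hrect q v
    rw [mfderiv_eq_fderiv] at h1
    refine h1.trans ?_
    rw [fderiv_norm_sq_apply]
    change (2 • (inner ℝ (posN n x q) (mvfderiv (𝓡 n) (posN n x) q v) : ℝ)) = 0
    rw [h2, smul_zero]
  exact (sq_eq_sq₀ (norm_nonneg _) (norm_nonneg _)).mp h

/-- The tangent vector was obtained by choice; injectivity of the differential pins down its
coordinates. -/
theorem IsIsometricImmersion.coords_posTVec (hx : IsIsometricImmersion n x) (p : M) (i : Fin n) :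
    coords p (posTVec n x p) i = tanCoeff (inChart x p) i (extChartAt (𝓡 n) p p) := by
  have hy := mem_extChartAt_target (I := 𝓡 n) p
  have h : coords p (posTVec n x p)
      = WithLp.toLp 2 fun k => tanCoeff (inChart x p) k (extChartAt (𝓡 n) p p) := by
    apply (hx.isParam p).injective _ hy
    have h1 := hx.posT_eq hy
    rw [extChartAt_symm_self] at h1
    rw [fderiv_inChart_coords (hx.mdifferentiableAt p), posTVec, mvfderiv_tangentVec,
      fderiv_eq_sum_pder]
    exact h1
  rw [h]

theorem IsIsometricImmersion.curvature_posTVec (hx : IsIsometricImmersion n x)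
    (hrect : IsRectifying n x) (p : M) (Y Z : TangentSpace (𝓡 n) p) :
    curvature p (posTVec n x p) Y Z = 0 := by
  have hy := mem_extChartAt_target (I := 𝓡 n) p
  have hF := hx.isParam p
  set a : Euc n := WithLp.toLp 2 fun l => ∑ i, ∑ j, ∑ k,
    curvCoeff p l i j k (extChartAt (𝓡 n) p p) * coords p (posTVec n x p) i * coords p Y j
      * coords p Z k with ha
  suffices h : a = 0 by
    change ofCoords p a = 0
    rw [h, ofCoords, map_zero]
  -- The image of `a` is tangent, so orthogonality to every coordinate vector forces it to be
  -- orthogonal to itself, hence zero.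
  have hq : ∀ q, (inner ℝ (fderiv ℝ (inChart x p) (extChartAt (𝓡 n) p p) a)
      (pder q (inChart x p) (extChartAt (𝓡 n) p p)) : ℝ) = 0 := by
    intro q
    have key := hF.sum_tanCoeff_mul_paramCurv
      (fun _ hz => hx.inner_paramN_pder_pder hrect hz) hy
    calc _ = ∑ j, ∑ k, coords p Y j * coords p Z k *
          ∑ i, tanCoeff (inChart x p) i (extChartAt (𝓡 n) p p) *
            ∑ l, paramCurv (inChart x p) l i j k (extChartAt (𝓡 n) p p)
              * (inner ℝ (pder l (inChart x p) (extChartAt (𝓡 n) p p))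
                (pder q (inChart x p) (extChartAt (𝓡 n) p p)) : ℝ) := by
          rw [fderiv_eq_sum_pder, sum_inner]
          simp only [inner_smul_left, conj_trivial, ha, hx.curvCoeff_eq hy, hx.coords_posTVec,
            Finset.sum_mul, Finset.mul_sum]
          rw [Finset.sum_comm]
          conv_lhs => enter [2, i]; rw [Finset.sum_comm]
          rw [Finset.sum_comm]
          refine Finset.sum_congr rfl fun j _ => ?_
          conv_lhs => enter [2, i]; rw [Finset.sum_comm]
          rw [Finset.sum_comm]
          refine Finset.sum_congr rfl fun k _ => Finset.sum_congr rfl fun i _ =>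
            Finset.sum_congr rfl fun l _ => ?_
          ring
      _ = 0 := by simp only [key, mul_zero, Finset.sum_const_zero]
  apply hF.injective _ hy
  rw [map_zero, ← inner_self_eq_zero (𝕜 := ℝ)]
  nth_rewrite 2 [fderiv_eq_sum_pder]
  rw [inner_sum]
  exact Finset.sum_eq_zero fun q _ => by rw [inner_smul_right, hq, mul_zero]

/-! ### The length of the tangential part as arclength coordinate -/

section Distance

variable [ConnectedSpace M] (hx : IsIsometricImmersion n x) (hrect : IsProperRectifying n x)
include hx hrect

/-- The length of the tangential part of the position vector is smooth, with gradient `e₁`. -/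
theorem IsIsometricImmersion.norm_posT_smooth :
    ContMDiff (𝓡 n) 𝓘(ℝ, ℝ) ∞ (fun p => ‖posT n x p‖) ∧
      ∀ (p : M) (v : TangentSpace (𝓡 n) p),
        mvfderiv (𝓡 n) (fun p => ‖posT n x p‖) p v = inner ℝ (unitT n x p) v := by
  obtain ⟨c, hc⟩ := hx.exists_norm_posN_eq hrect.1
  have hpos := hrect.norm_posT_pos
  have hsq : ∀ p, ‖posT n x p‖ ^ 2 = ‖x p‖ ^ 2 - c ^ 2 := fun p => by
    rw [norm_sq_eq_add (n := n) (x := x) p, hc]; ring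
  -- With `|N| = c` constant, `|T|` is an explicit function of `x`, smooth because the radicand
  -- `|T|²` never vanishes.
  have heq : (fun p => ‖posT n x p‖) = (fun w : Euc m => √(‖w‖ ^ 2 - c ^ 2)) ∘ x := by
    ext p
    rw [Function.comp_apply, ← hsq, Real.sqrt_sq (norm_nonneg _)]
  have hne : ∀ p, ‖x p‖ ^ 2 - c ^ 2 ≠ 0 := fun p => by
    rw [← hsq]; exact (pow_pos (hpos p) 2).ne'
  have hg : ∀ p, ContDiffAt ℝ ∞ (fun w : Euc m => √(‖w‖ ^ 2 - c ^ 2)) (x p) := fun p =>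
    ((contDiffAt_id.norm_sq ℝ).sub contDiffAt_const).sqrt (hne p)
  refine ⟨fun p => ?_, fun p v => ?_⟩
  · rw [heq]
    exact (hg p).contMDiffAt.comp p (hx.1 p)
  · have h1 := mfderiv_comp_apply p (((hg p).differentiableAt (by simp)).mdifferentiableAt)
      (hx.mdifferentiableAt p) v
    rw [mfderiv_eq_fderiv] at h1
    rw [heq]
    refine h1.trans ?_
    have hd : HasFDerivAt (fun w : Euc m => ‖w‖ ^ 2 - c ^ 2) (2 • innerSL ℝ (x p)) (x p) :=
      (hasStrictFDerivAt_norm_sq (x p)).hasFDerivAt.sub_const _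
    rw [(hd.sqrt (hne p)).fderiv]
    have h2 : (inner ℝ (x p) (mvfderiv (𝓡 n) x p v) : ℝ) = inner ℝ (posTVec n x p) v := by
      rw [← inner_posT_mvfderiv, posT, ← mvfderiv_tangentVec, hx.2]
      rfl
    rw [unitT, inner_smul_left, ← h2, hx.norm_posTVec, ← hsq, Real.sqrt_sq (norm_nonneg _)]
    change (1 / (2 * ‖posT n x p‖)) * (2 • inner ℝ (x p) (mvfderiv (𝓡 n) x p v) : ℝ) = _
    have := (hpos p).ne'
    simp only [nsmul_eq_mul, conj_trivial]
    field_simp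
    simp

/-- This supplies the existence of `s`, globally on `M` and without constructing adapted
coordinates. -/
theorem IsIsometricImmersion.isArclengthCoord_norm_posT (U : Set M) :
    IsArclengthCoord n x U (fun p => ‖posT n x p‖) := by
  obtain ⟨h1, h2⟩ := hx.norm_posT_smooth hrect
  refine ⟨h1.contMDiffOn, fun p _ => ⟨?_, fun v hv => ?_⟩⟩
  · rw [h2, hx.inner_unitT_self hrect]
  · rw [h2, real_inner_comm, hv]

theorem IsIsometricImmersion.exists_norm_posT_eq_add {U : Set M} {s : M → ℝ} (hU : IsOpen U)
    (hc : IsConnected U) (hs : IsArclengthCoord n x U s) :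
    ∃ b : ℝ, ∀ p ∈ U, ‖posT n x p‖ = s p + b := by
  obtain ⟨q, hq⟩ := hc.nonempty
  obtain ⟨h1, h2⟩ := hx.norm_posT_smooth hrect
  have hsd : ∀ p ∈ U, MDifferentiableAt (𝓡 n) 𝓘(ℝ, ℝ) s p := fun p hp =>
    (hs.1.contMDiffAt (hU.mem_nhds hp)).mdifferentiableAt (by simp)
  have hnd : ∀ p, MDifferentiableAt (𝓡 n) 𝓘(ℝ, ℝ) (fun p => ‖posT n x p‖) p := fun p =>
    (h1 p).mdifferentiableAt (by simp)
  refine ⟨‖posT n x q‖ - s q, fun p hp => ?_⟩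
  have h := eq_of_mvfderiv_eq_zero (n := n) (f := (fun p => ‖posT n x p‖) - s) hU
    hc.isPreconnected (fun z hz => (hnd z).sub (hsd z hz)) (fun z hz v => by
      rw [mvfderiv_sub (hnd z) (hsd z hz)]
      change mvfderiv (𝓡 n) (fun p => ‖posT n x p‖) z v - mvfderiv (𝓡 n) s z v = 0
      rw [h2, hx.mvfderiv_eq_inner_unitT hrect hs hz, sub_self]) hp hq
  simp only [Pi.sub_apply] at h
  linarith

end Distance

end Position

end RectSub

end

open RectSub in
theorem theorem5p1 {n m : ℕ} {M : Type*} [TopologicalSpace M] [ConnectedSpace M]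
    [ChartedSpace (Euc n) M] [IsManifold (𝓡 n) ∞ M]
    [RiemannianBundle (fun p : M => TangentSpace (𝓡 n) p)]
    [IsContMDiffRiemannianBundle (𝓡 n) ∞ (Euc n) (fun p : M => TangentSpace (𝓡 n) p)]
    (x : M → Euc m) (hx : IsIsometricImmersion n x) (hrect : IsProperRectifying n x) :
    -- near every point there is a function `s` as in (a) and (b)
    (∀ p : M, ∃ U : Set M, IsOpen U ∧ IsConnected U ∧ p ∈ U ∧
      ∃ s : M → ℝ, IsArclengthCoord n x U s) ∧
    -- (a), (b)
    (∀ (U : Set M) (s : M → ℝ), IsOpen U → IsConnected U → IsArclengthCoord n x U s →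
      (∃ b : ℝ, ∀ p ∈ U, ‖posT n x p‖ = s p + b) ∧
      (∃ c₁ c₂ : ℝ, ∀ p ∈ U, ‖x p‖ ^ 2 = s p ^ 2 + c₁ * s p + c₂)) ∧
    -- (c)
    (∃ c : ℝ, ∀ p : M, ‖posN n x p‖ = c) ∧
    -- (d)
    (∀ (p : M) (v : TangentSpace (𝓡 n) p), shapeOperator n x (posN n x) p v = 0) ∧
    -- (e)
    (∀ (p : M) (Y Z : TangentSpace (𝓡 n) p), curvature p (posTVec n x p) Y Z = 0) ∧
    -- (f)
    (∀ (p : M) (Z : TangentSpace (𝓡 n) p), ‖Z‖ = 1 → inner ℝ (posTVec n x p) Z = 0 →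
      sectionalCurvature p (posTVec n x p) Z = 0) := by
  refine ⟨fun p => ⟨Set.univ, isOpen_univ, isConnected_univ, Set.mem_univ p, _,
      hx.isArclengthCoord_norm_posT hrect Set.univ⟩, fun U s hU hc hs => ?_,
    hx.exists_norm_posN_eq hrect.1, hx.shapeOperator_posN hrect.1,
    hx.curvature_posTVec hrect.1, fun p Z _ _ => ?_⟩
  · obtain ⟨b, hb⟩ := hx.exists_norm_posT_eq_add hrect hU hc hs
    obtain ⟨c, hN⟩ := hx.exists_norm_posN_eq hrect.1
    -- Expand `|x|² = |T|² + |N|² = (s + b)² + c²`.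
    refine ⟨⟨b, hb⟩, 2 * b, b ^ 2 + c ^ 2, fun p hp => ?_⟩
    rw [norm_sq_eq_add (n := n) p, hb p hp, hN]
    ring
  · rw [sectionalCurvature, hx.curvature_posTVec hrect.1, inner_zero_left, zero_div]
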